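/- Let $\mathcal C$ be a Markov category: a symmetric monoidal category with terminal unit $I$ in which every object $X$ carries a commutative comonoid structure $(\mathrm{copy}_X,\mathrm{del}_X)$ compatible with the monoidal structure. Assume that $\mathcal C$ has conditionals: for every $f:A\to X\otimes Y$ there is $f_{|X}:X\otimes A\to Y$ such that $$f=(\mathrm{id}_X\otimes f_{|X})\circ(\mathrm{copy}_X\otimes \mathrm{id}_A)\circ(f_X\otimes\mathrm{id}_A)\circ\mathrm{copy}_A,$$ where $f_X=(\mathrm{id}_X\otimes\mathrm{del}_Y)\circ f$ is the marginal of $f$ on $X$. For a state $p:I\to X$, morphisms $f,g:X\to Y$ are $p$-a.s. equal, $f\simeq_p g$, if $(\mathrm{id}_X\otimes f)\circ\mathrm{copy}_X\circ p=(\mathrm{id}_X\otimes g)\circ\mathrm{copy}_X\circ p$, and $f$ is $p$-a.s. deterministic if $\mathrm{copy}_Y\circ f\simeq_p(f\otimes f)\circ\mathrm{copy}_X$. A Bayesian inverse of $f$ relative to $p$ is a morphism $f^\dagger:Y\to X$ with $(\mathrm{id}_X\otimes f)\circ\mathrm{copy}_X\circ p=(f^\dagger\otimes\mathrm{id}_Y)\circ\mathrm{copy}_Y\circ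 f\circ p$. Let $\mathrm{PS}(\mathcal C)$ be the category whose objects are pairs $(X,p)$ of an object of $\mathcal C$ and a state on it, and whose morphisms $(X,p)\to(Y,q)$ are the morphisms $f:X\to Y$ with $f\circ p=q$, modulo $p$-a.s. equality. Since $\mathcal C$ has conditionals, Bayesian inverses exist and are a.s. unique, so each $f:(X,p)\to(Y,q)$ of $\mathrm{PS}(\mathcal C)$ determines a morphism $f^\dagger:(Y,q)\to(X,p)$ of $\mathrm{PS}(\mathcal C)$. A dynamical system in $\mathrm{PS}(\mathcal C)$ on $(X,p)$ with monoid $M$ is a functor $D:M\to\mathrm{PS}(\mathcal C)$ from $M$, seen as a one-object category, with value $(X,p)$; the image of $m\in M$ is again written $m:(X,p)\to(X,p)$. An invariant object for $D$ is a colimit $r:(X,p)\to(X_{\mathrm{inv}},p_{\mathrm{inv}})$ of $D$ in $\mathrm{PS}(\mathcal C)$ such that for every morphism $f:(X,p)\to(Y,q)$ with $f\circ m\simeq_p f$ for all $m\in M$, with induced morphism $\tilde f:(X_{\mathrm{inv}},p_{\mathrm{inv}})\to(Y,q)$, $f$ is $p$-a.s. deterministic if and only if $\tilde f$ is $p_{\mathrm{inv}}$-a.s.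 deterministic. **Theorem.** Suppose that every dynamical system in $\mathrm{PS}(\mathcal C)$ has an invariant object. Let $D$ be a dynamical system in $\mathrm{PS}(\mathcal C)$ on $(X,p)$ with monoid $M$, and let $r:(X,p)\to(X_{\mathrm{inv}},p_{\mathrm{inv}})$ be an invariant object for $D$. Then $(X_{\mathrm{inv}},p_{\mathrm{inv}})$ is also the limit of $D$ in $\mathrm{PS}(\mathcal C)$, with limiting cone the Bayesian inverse $r^\dagger:(X_{\mathrm{inv}},p_{\mathrm{inv}})\to(X,p)$ of $r$. In particular $m\circ r^\dagger\simeq_{p_{\mathrm{inv}}}r^\dagger$ for all $m\in M$, and for every $g:(A,q)\to(X,p)$ in $\mathrm{PS}(\mathcal C)$ with $m\circ g\simeq_q g$ for all $m\in M$ there is a $q$-a.s. unique $\tilde g:(A,q)\to(X_{\mathrm{inv}},p_{\mathrm{inv}})$ in $\mathrm{PS}(\mathcal C)$ with $g\simeq_q r^\dagger\circ\tilde g$. -/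

import Mathlib

open CategoryTheory MonoidalCategory ComonObj Limits

universe w v u

namespace MarkovPS

section Markov

variable {C : Type u} [Category.{v} C] [MonoidalCategory.{v} C] [MarkovCategory C]

/-- `f` and `g` are `p`-almost surely equal. (In a Markov category a state on `X` is a morphism
`p : 𝟙_ C ⟶ X`; the same equation makes sense for any `p : A ⟶ X`.) -/
def ASEq {A X Y : C} (p : A ⟶ X) (f g : X ⟶ Y) : Prop :=
  p ≫ Δ[X] ≫ X ◁ f = p ≫ Δ[X] ≫ X ◁ g

/-- `f` is `p`-almost surely deterministic: copying its output is, `p`-almost surely, the same as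
running it independently on two copies of the input. -/
def ASDeterministic {A X Y : C} (p : A ⟶ X) (f : X ⟶ Y) : Prop :=
  ASEq p (f ≫ Δ[Y]) (Δ[X] ≫ (f ⊗ₘ f))

/-- `g : Y ⟶ X` is a Bayesian inverse of `f : X ⟶ Y` relative to the state `p` on `X`: the joint
state on `X ⊗ Y` obtained from `p` and `f` equals the one obtained from `p ≫ f` and `g`. -/
def IsBayesianInverse {X Y : C} (p : 𝟙_ C ⟶ X) (f : X ⟶ Y) (g : Y ⟶ X) : Prop :=
  p ≫ Δ[X] ≫ X ◁ f = (p ≫ f) ≫ Δ[Y] ≫ g ▷ Y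

variable (C) in
/-- A Markov category is causal if whenever `h₁` and `h₂` agree almost surely with respect to
`f ≫ g`, they also agree jointly with the output of `f`. -/
class Causal : Prop where
  causal {A X Y Z : C} (f : A ⟶ X) (g : X ⟶ Y) (h₁ h₂ : Y ⟶ Z) :
    ASEq (f ≫ g) h₁ h₂ → ASEq f (g ≫ Δ[Y] ≫ Y ◁ h₁) (g ≫ Δ[Y] ≫ Y ◁ h₂)

variable (C) in
/-- A Markov category has conditionals if every `f : A ⟶ X ⊗ Y` can be generated by first
generating its marginal on `X`, and then the output in `Y` from the output in `X` and the input
in `A`. -/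
class HasConditionals : Prop where
  exists_conditional {A X Y : C} (f : A ⟶ X ⊗ Y) :
    ∃ k : X ⊗ A ⟶ Y,
      f = Δ[A] ≫ (((f ≫ X ◁ ε[Y] ≫ (ρ_ X).hom) ≫ Δ[X]) ▷ A) ≫ (α_ X X A).hom ≫ X ◁ k

theorem copy_braid (X : C) : Δ[X] ≫ (β_ X X).hom = Δ[X] := IsCommComonObj.comul_comm X

theorem copy_fst {Y Z : C} (g : Y ⟶ Z) :
    (Δ[Y] ≫ Y ◁ g) ≫ ε[Y] ▷ Z ≫ (λ_ Z).hom = g := by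
  rw [Category.assoc, whisker_exchange_assoc, counit_comul_assoc]
  simp

theorem copy_snd {Y Z : C} (g : Y ⟶ Z) :
    (Δ[Y] ≫ g ▷ Y) ≫ Z ◁ ε[Y] ≫ (ρ_ Z).hom = g := by
  rw [Category.assoc, ← whisker_exchange_assoc, comul_counit_assoc]
  simp

/-- Swapping the two outputs of a copied input. -/
theorem copy_swap {X Y : C} (f : X ⟶ Y) :
    Δ[X] ≫ X ◁ f = (Δ[X] ≫ f ▷ X) ≫ (β_ Y X).hom := by
  rw [Category.assoc, BraidedCategory.braiding_naturality_left, ← Category.assoc, copy_braid]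

theorem copy_swap' {X Y : C} (f : X ⟶ Y) :
    Δ[X] ≫ f ▷ X = (Δ[X] ≫ X ◁ f) ≫ (β_ X Y).hom := by
  rw [Category.assoc, BraidedCategory.braiding_naturality_right, ← Category.assoc, copy_braid]

theorem asEq_iff_right {A X Y : C} {p : A ⟶ X} {f g : X ⟶ Y} :
    ASEq p f g ↔ p ≫ Δ[X] ≫ f ▷ X = p ≫ Δ[X] ≫ g ▷ X := by
  unfold ASEq
  constructor
  · intro h
    rw [copy_swap', copy_swap', ← Category.assoc, h, Category.assoc]
  · intro h
    rw [copy_swap, copy_swap, ← Category.assoc, h, Category.assoc]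

theorem ASEq.comp_right {A X Y Z : C} {p : A ⟶ X} {f g : X ⟶ Y} (h : ASEq p f g) (k : Y ⟶ Z) :
    ASEq p (f ≫ k) (g ≫ k) := by
  unfold ASEq at *
  have := congrArg (· ≫ X ◁ k) h
  simpa using this

theorem ASEq.comp_left [Causal C] {A X Y Z : C} {p : A ⟶ X} (f : X ⟶ Y) {g h : Y ⟶ Z}
    (e : ASEq (p ≫ f) g h) : ASEq p (f ≫ g) (f ≫ h) := by
  have := (Causal.causal p f g h e).comp_right (ε[Y] ▷ Z ≫ (λ_ Z).hom)
  rwa [Category.assoc, copy_fst, Category.assoc, copy_fst] at this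

theorem copy_three (Y : C) :
    Δ[Y] ≫ Δ[Y] ▷ Y ≫ (α_ Y Y Y).hom ≫ Y ◁ (β_ Y Y).hom ≫ (α_ Y Y Y).inv =
      Δ[Y] ≫ Δ[Y] ▷ Y := by
  have := comul_assoc Y
  have h2 : Δ[Y] ≫ Δ[Y] ▷ Y = Δ[Y] ≫ Y ◁ Δ[Y] ≫ (α_ Y Y Y).inv := by
    rw [comul_assoc_assoc]; simp
  rw [← comul_assoc_assoc, h2, ← MonoidalCategory.whiskerLeft_comp_assoc, copy_braid]

theorem copy_copy {Y Z : C} (h : Y ⟶ Z) :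
    Δ[Y] ≫ (Δ[Y] ≫ Y ◁ h) ▷ Y =
      (Δ[Y] ≫ Y ◁ h) ≫ Δ[Y] ▷ Z ≫ (α_ Y Y Z).hom ≫ Y ◁ (β_ Y Z).hom ≫ (α_ Y Z Y).inv := by
  rw [comp_whiskerRight, ← Category.assoc, ← copy_three]
  simp only [Category.assoc]
  rw [whisker_exchange_assoc]
  congr 2
  simp [← MonoidalCategory.whiskerLeft_comp]

theorem causal_of_hasConditionals [HasConditionals C] {A X Y Z : C} (f : A ⟶ X) (g : X ⟶ Y)
    (h₁ h₂ : Y ⟶ Z) (e : ASEq (f ≫ g) h₁ h₂) :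
    ASEq f (g ≫ Δ[Y] ≫ Y ◁ h₁) (g ≫ Δ[Y] ≫ Y ◁ h₂) := by
  obtain ⟨k, hk⟩ := HasConditionals.exists_conditional (f ≫ Δ[X] ≫ g ▷ X)
  have hm : (f ≫ Δ[X] ≫ g ▷ X) ≫ Y ◁ ε[X] ≫ (ρ_ Y).hom = f ≫ g := by
    rw [Category.assoc, copy_snd]
  rw [hm] at hk
  have key : ∀ h : Y ⟶ Z, f ≫ Δ[X] ≫ (g ≫ Δ[Y] ≫ Y ◁ h) ▷ X =
      Δ[A] ≫ (((f ≫ g) ≫ Δ[Y] ≫ Y ◁ h) ≫ Δ[Y] ▷ Z ≫ (α_ Y Y Z).hom ≫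
        Y ◁ (β_ Y Z).hom ≫ (α_ Y Z Y).inv) ▷ A ≫ (α_ (Y ⊗ Z) Y A).hom ≫ (Y ⊗ Z) ◁ k := by
    intro h
    have h1 : f ≫ Δ[X] ≫ (g ≫ Δ[Y] ≫ Y ◁ h) ▷ X =
        (f ≫ Δ[X] ≫ g ▷ X) ≫ (Δ[Y] ≫ Y ◁ h) ▷ X := by simp
    rw [h1, hk, Category.assoc (f ≫ g), ← copy_copy h]
    simp only [Category.assoc]
    rw [whisker_exchange]
    simp
  rw [asEq_iff_right, key, key, e]

instance [HasConditionals C] : Causal C where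
  causal := causal_of_hasConditionals

theorem asEq_refl {A X Y : C} (p : A ⟶ X) (f : X ⟶ Y) : ASEq p f f := rfl

/-- Almost sure equality is preserved by attaching further copies of the input. -/
theorem ASEq.copy_left {A X Y W : C} {p : A ⟶ X} {f g : X ⟶ Y} (h : ASEq p f g) (k : X ⟶ W) :
    ASEq p (Δ[X] ≫ (k ⊗ₘ f)) (Δ[X] ≫ (k ⊗ₘ g)) := by
  have key : ∀ f : X ⟶ Y, Δ[X] ≫ X ◁ (Δ[X] ≫ (k ⊗ₘ f)) =
      (Δ[X] ≫ X ◁ f) ≫ (Δ[X] ≫ X ◁ k) ▷ Y ≫ (α_ X W Y).hom := by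
    intro f
    rw [MonoidalCategory.whiskerLeft_comp, comul_assoc_assoc, Category.assoc,
      whisker_exchange_assoc]
    simp [MonoidalCategory.tensorHom_def]
  unfold ASEq
  rw [key, key, ← Category.assoc, h, Category.assoc]

theorem ASEq.copy_right {A X Y W : C} {p : A ⟶ X} {f g : X ⟶ Y} (h : ASEq p f g) (k : X ⟶ W) :
    ASEq p (Δ[X] ≫ (f ⊗ₘ k)) (Δ[X] ≫ (g ⊗ₘ k)) := by
  have key : ∀ f : X ⟶ Y, Δ[X] ≫ (f ⊗ₘ k) = (Δ[X] ≫ (k ⊗ₘ f)) ≫ (β_ W Y).hom := by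
    intro f
    rw [Category.assoc, BraidedCategory.braiding_naturality, ← Category.assoc, copy_braid]
  rw [key, key]
  exact (h.copy_left k).comp_right _

theorem ASDeterministic.congr {A X Y : C} {p : A ⟶ X} {f g : X ⟶ Y} (h : ASEq p f g)
    (hf : ASDeterministic p f) : ASDeterministic p g :=
  ((h.comp_right Δ[Y]).symm.trans hf).trans ((h.copy_left f).trans (h.copy_right g))

theorem exists_isBayesianInverse [HasConditionals C] {X Y : C} (p : 𝟙_ C ⟶ X) (f : X ⟶ Y) :
    ∃ g : Y ⟶ X, IsBayesianInverse p f g := by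
  obtain ⟨k, hk⟩ := HasConditionals.exists_conditional (p ≫ Δ[X] ≫ f ▷ X)
  have hm : (p ≫ Δ[X] ≫ f ▷ X) ≫ Y ◁ ε[X] ≫ (ρ_ Y).hom = p ≫ f := by
    rw [Category.assoc, copy_snd]
  rw [hm, CopyDiscardCategory.copy_unit] at hk
  refine ⟨(ρ_ Y).inv ≫ k, ?_⟩
  unfold IsBayesianInverse
  rw [copy_swap f, copy_swap' ((ρ_ Y).inv ≫ k), ← Category.assoc, hk, ← Category.assoc (p ≫ f)]
  congr 1
  rw [unitors_inv_equal, ← rightUnitor_inv_naturality_assoc]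
  simp

theorem IsBayesianInverse.comp_eq {X Y : C} {p : 𝟙_ C ⟶ X} {f : X ⟶ Y} {g : Y ⟶ X}
    (h : IsBayesianInverse p f g) : (p ≫ f) ≫ g = p := by
  have := congrArg (· ≫ X ◁ ε[Y] ≫ (ρ_ X).hom) h
  simp only [Category.assoc] at this
  have h2 := copy_snd g
  simp only [Category.assoc] at h2
  rw [h2, ← MonoidalCategory.whiskerLeft_comp_assoc, MarkovCategory.discard_natural,
    comul_counit_assoc, Iso.inv_hom_id, Category.comp_id] at this
  rw [Category.assoc, ← this]

/-- A morphism is a Bayesian inverse of `f` if and only if it is almost surely equal to a given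
Bayesian inverse. -/
theorem IsBayesianInverse.iff_asEq {X Y : C} {p : 𝟙_ C ⟶ X} {f : X ⟶ Y} {g g' : Y ⟶ X}
    (h : IsBayesianInverse p f g) : IsBayesianInverse p f g' ↔ ASEq (p ≫ f) g g' := by
  rw [asEq_iff_right, IsBayesianInverse, show _ = _ from h]

theorem IsBayesianInverse.congr {X Y : C} {p : 𝟙_ C ⟶ X} {f f' : X ⟶ Y} {g : Y ⟶ X}
    (h : IsBayesianInverse p f g) (e : ASEq p f f') (e' : p ≫ f = p ≫ f') :
    IsBayesianInverse p f' g := by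
  unfold IsBayesianInverse
  rw [← e', ← show _ = _ from h, show _ = _ from e]

end Markov

/-- Objects of `PS(C)`: objects of `C` equipped with a state. -/
structure PS (C : Type u) [Category.{v} C] [MonoidalCategory.{v} C] where
  obj : C
  state : 𝟙_ C ⟶ obj

namespace PS

variable {C : Type u} [Category.{v} C] [MonoidalCategory.{v} C] [MarkovCategory C]

/-- State-preserving morphisms of `C`. -/
def PreHom (X Y : PS C) : Type v :=
  { f : X.obj ⟶ Y.obj // X.state ≫ f = Y.state }

/-- State-preserving morphisms up to almost sure equality. -/
instance homSetoid (X Y : PS C) : Setoid (PreHom X Y) where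
  r f g := ASEq X.state f.1 g.1
  iseqv := ⟨fun _ => rfl, fun h => Eq.symm h, fun h k => Eq.trans h k⟩

/-- The category `PS(C)` of a causal Markov category `C`. -/
instance [Causal C] : Category.{v} (PS C) where
  Hom X Y := Quotient (homSetoid X Y)
  id X := Quotient.mk _ ⟨𝟙 X.obj, Category.comp_id _⟩
  comp {X Y Z} f g := Quotient.map₂
    (fun (f : PreHom X Y) (g : PreHom Y Z) =>
      (⟨f.1 ≫ g.1, by rw [← Category.assoc, f.2, g.2]⟩ : PreHom X Z))
    (fun f f' hf g g' hg => by
      change ASEq X.state (f.1 ≫ g.1) (f'.1 ≫ g'.1)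
      have hg' : ASEq (X.state ≫ f'.1) g.1 g'.1 := by rw [f'.2]; exact hg
      exact (ASEq.comp_right hf g.1).trans (ASEq.comp_left f'.1 hg')) f g
  id_comp := by
    rintro X Y ⟨f⟩
    exact congrArg (Quotient.mk _) (Subtype.ext (Category.id_comp f.1))
  comp_id := by
    rintro X Y ⟨f⟩
    exact congrArg (Quotient.mk _) (Subtype.ext (Category.comp_id f.1))
  assoc := by
    rintro X Y Z W ⟨f⟩ ⟨g⟩ ⟨h⟩
    exact congrArg (Quotient.mk _) (Subtype.ext (Category.assoc f.1 g.1 h.1))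

/-- The morphism of `PS(C)` represented by a state-preserving morphism of `C`. -/
def homMk [Causal C] {X Y : PS C} (f : X.obj ⟶ Y.obj) (hf : X.state ≫ f = Y.state) : X ⟶ Y :=
  Quotient.mk (homSetoid X Y) ⟨f, hf⟩

theorem homMk_eq_iff [Causal C] {X Y : PS C} {f g : X.obj ⟶ Y.obj}
    {hf : X.state ≫ f = Y.state} {hg : X.state ≫ g = Y.state} :
    homMk f hf = homMk g hg ↔ ASEq X.state f g :=
  Quotient.eq (r := homSetoid X Y)

/-- A morphism of `PS(C)` is almost surely deterministic if its representatives are. -/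
def IsASDeterministic [Causal C] {X Y : PS C} (f : X ⟶ Y) : Prop :=
  Quotient.lift (s := homSetoid X Y) (fun g => ASDeterministic X.state g.1)
    (fun _ _ h => propext ⟨ASDeterministic.congr h, ASDeterministic.congr (Eq.symm h)⟩) f

/-- The dagger of `PS(C)`, given by Bayesian inversion. -/
noncomputable def dagger [HasConditionals C] {X Y : PS C} (f : X ⟶ Y) : Y ⟶ X :=
  Quotient.lift (s := homSetoid X Y)
    (fun g => homMk (X := Y) (Y := X) (exists_isBayesianInverse X.state g.1).choose (by
      have := (exists_isBayesianInverse X.state g.1).choose_spec.comp_eq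
      rwa [g.2] at this))
    (fun g g' h => by
      rw [homMk_eq_iff]
      have h1 := (exists_isBayesianInverse X.state g.1).choose_spec
      have h2 := (exists_isBayesianInverse X.state g'.1).choose_spec
      have := (h1.congr h (g.2.trans g'.2.symm)).iff_asEq.1 h2
      rwa [g'.2] at this) f

/-- The morphisms representing `dagger f` are exactly the Bayesian inverses of `f`. -/
theorem dagger_homMk_eq_iff [HasConditionals C] {X Y : PS C} {f : X.obj ⟶ Y.obj}
    {hf : X.state ≫ f = Y.state} {g : Y.obj ⟶ X.obj} {hg : Y.state ≫ g = X.state} :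
    dagger (homMk f hf) = homMk g hg ↔ IsBayesianInverse X.state f g := by
  have h1 := (exists_isBayesianInverse X.state f).choose_spec
  rw [h1.iff_asEq, hf]
  exact homMk_eq_iff

end PS

section Dynamics

variable {M : Type w} [Monoid M] {E : Type u} [Category.{v} E]

/-- A dynamical system in `E` with monoid `M` is a functor `D : SingleObj M ⥤ E`; this is the
object on which it acts. -/
abbrev space (D : SingleObj M ⥤ E) : E := D.obj (SingleObj.star M)

/-- The endomorphism by which `m : M` acts. -/
abbrev act (D : SingleObj M ⥤ E) (m : M) : space D ⟶ space D :=
  D.map (X := SingleObj.star M) (Y := SingleObj.star M) m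

/-- Left-invariant morphisms `h : A ⟶ X`: `m ∘ h = h` for all `m`. -/
def IsLeftInvariant (D : SingleObj M ⥤ E) {A : E} (h : A ⟶ space D) : Prop :=
  ∀ m : M, h ≫ act D m = h

/-- Left-invariant morphisms are the cones over `D`. -/
def IsLeftInvariant.cone {D : SingleObj M ⥤ E} {A : E} {h : A ⟶ space D}
    (hh : IsLeftInvariant D h) : Cone D where
  pt := A
  π :=
    { app := fun _ => h
      naturality := fun _ _ m => (Category.id_comp h).trans (hh m).symm }

/-- The leg of a cocone under `D`, a right-invariant morphism. -/
abbrev leg {D : SingleObj M ⥤ E} (c : Cocone D) : space D ⟶ c.pt :=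
  c.ι.app (SingleObj.star M)

end Dynamics

section Invariant

variable {C : Type u} [Category.{v} C] [MonoidalCategory.{v} C] [MarkovCategory C] [Causal C]

/-- An invariant object of a dynamical system in `PS(C)`: a colimit such that a right-invariant
morphism is almost surely deterministic if and only if the induced morphism out of the colimit
is. -/
def IsInvariantObject {M : Type w} [Monoid M] {D : SingleObj M ⥤ PS C} (c : Cocone D) : Prop :=
  ∃ hc : IsColimit c, ∀ s : Cocone D,
    PS.IsASDeterministic (leg s) ↔ PS.IsASDeterministic (hc.desc s)

variable (C) in
/-- `PS(C)` has all invariant objects (of dynamical systems indexed by monoids in `Type w`). -/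
def HasInvariantObjects : Prop :=
  ∀ (M : Type w) [Monoid M] (D : SingleObj M ⥤ PS C), ∃ c : Cocone D, IsInvariantObject c

end Invariant

end MarkovPS

/-! Conditionals make positivity hold almost surely: if `f ≫ g` is a.s. deterministic, then the
outputs of `f` and of `f ≫ g` are independent given the input. In terms of Bayesian inverses, this
says `(f ≫ g)† ≫ f = g†`. Hence the legs of an a.s. deterministic cocone under a diagram `D` have
inverses forming a cone over `D`, and an a.s. deterministic cocone under the reversed diagram `D†`
is also a cocone under `D`. A cone over `D` inverts to a cocone under `D†`; it factors through the
colimit of `D†`, hence through that of `D`, and inverting once more gives the factorization required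
of a limit. -/

namespace MarkovPS

section Markov

variable {C : Type u} [Category.{v} C] [MonoidalCategory.{v} C] [MarkovCategory C]

theorem copy_tensorHom_braid {X Y Z : C} (f : X ⟶ Y) (g : X ⟶ Z) :
    Δ[X] ≫ (f ⊗ₘ g) = (Δ[X] ≫ (g ⊗ₘ f)) ≫ (β_ Z Y).hom := by
  rw [Category.assoc, BraidedCategory.braiding_naturality, ← Category.assoc, copy_braid]

theorem comp_copy_of_asDeterministic_comp [HasConditionals C] {A X Y Z : C} {p : A ⟶ X}
    {f : X ⟶ Y} {g : Y ⟶ Z} (h : ASDeterministic p (f ≫ g)) :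
    p ≫ f ≫ Δ[Y] ≫ g ▷ Y = p ≫ Δ[X] ≫ ((f ≫ g) ⊗ₘ f) := by
  obtain ⟨k, hk⟩ := HasConditionals.exists_conditional (f ≫ Δ[Y] ≫ g ▷ Y)
  rw [Category.assoc f, copy_snd] at hk
  have hf : f = Δ[X] ≫ (f ≫ g) ▷ X ≫ k := calc
    f = (f ≫ Δ[Y] ≫ g ▷ Y) ≫ ε[Z] ▷ Y ≫ (λ_ Y).hom := by
        rw [Category.assoc, Category.assoc, ← comp_whiskerRight_assoc,
          MarkovCategory.discard_natural]
        simp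
    _ = Δ[X] ≫ (((f ≫ g) ≫ Δ[Z]) ▷ X ≫ (α_ Z Z X).hom ≫ ε[Z] ▷ (Z ⊗ X) ≫
          (λ_ (Z ⊗ X)).hom) ≫ k := by
        rw [hk]
        simp [whisker_exchange_assoc]
    _ = Δ[X] ≫ (f ≫ g) ▷ X ≫ k := by
        simp only [whiskerRight_tensor, Category.assoc, Iso.hom_inv_id_assoc,
          ← comp_whiskerRight_assoc, counit_comul]
        simp
  calc p ≫ f ≫ Δ[Y] ≫ g ▷ Y
      = (p ≫ Δ[X] ≫ ((f ≫ g) ≫ Δ[Z]) ▷ X) ≫ (α_ Z Z X).hom ≫ Z ◁ k := by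
        simp only [hk, Category.assoc]
    _ = p ≫ (Δ[X] ≫ Δ[X] ▷ X ≫ (α_ X X X).hom) ≫ ((f ≫ g) ⊗ₘ ((f ≫ g) ▷ X ≫ k)) := by
        rw [asEq_iff_right.1 h]
        simp [MonoidalCategory.tensorHom_def]
    _ = p ≫ Δ[X] ≫ ((f ≫ g) ⊗ₘ (Δ[X] ≫ (f ≫ g) ▷ X ≫ k)) := by
        simp [MonoidalCategory.tensorHom_def', comul_assoc_assoc]
    _ = p ≫ Δ[X] ≫ ((f ≫ g) ⊗ₘ f) := by rw [← hf]

theorem IsBayesianInverse.comp_of_asDeterministic [HasConditionals C] {X Y Z : C} {p : 𝟙_ C ⟶ X}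
    {f : X ⟶ Y} {g : Y ⟶ Z} {h : Z ⟶ X} (hfg : ASDeterministic p (f ≫ g))
    (hh : IsBayesianInverse p (f ≫ g) h) : IsBayesianInverse (p ≫ f) g (h ≫ f) := by
  unfold IsBayesianInverse at *
  calc (p ≫ f) ≫ Δ[Y] ≫ Y ◁ g
      = (p ≫ f ≫ Δ[Y] ≫ g ▷ Y) ≫ (β_ Z Y).hom := by simp only [copy_swap, Category.assoc]
    _ = p ≫ Δ[X] ≫ (f ⊗ₘ (f ≫ g)) := by
        rw [comp_copy_of_asDeterministic_comp hfg, copy_tensorHom_braid f, Category.assoc]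
    _ = (p ≫ Δ[X] ≫ X ◁ (f ≫ g)) ≫ f ▷ Z := by
        simp only [MonoidalCategory.tensorHom_def', Category.assoc]
    _ = ((p ≫ f) ≫ g) ≫ Δ[Z] ≫ (h ≫ f) ▷ Z := by
        rw [hh]; simp only [comp_whiskerRight, Category.assoc]

theorem isBayesianInverse_id {X : C} (p : 𝟙_ C ⟶ X) : IsBayesianInverse p (𝟙 X) (𝟙 X) := by
  simp [IsBayesianInverse]

theorem IsBayesianInverse.comp {X Y Z : C} {p : 𝟙_ C ⟶ X} {f : X ⟶ Y} {g : Y ⟶ Z} {f' : Y ⟶ X}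
    {g' : Z ⟶ Y} (hf : IsBayesianInverse p f f') (hg : IsBayesianInverse (p ≫ f) g g') :
    IsBayesianInverse p (f ≫ g) (g' ≫ f') := by
  unfold IsBayesianInverse at *
  calc p ≫ Δ[X] ≫ X ◁ (f ≫ g)
      = (p ≫ Δ[X] ≫ X ◁ f) ≫ X ◁ g := by simp
    _ = ((p ≫ f) ≫ Δ[Y] ≫ Y ◁ g) ≫ f' ▷ Z := by simp [hf, whisker_exchange]
    _ = (p ≫ f ≫ g) ≫ Δ[Z] ≫ (g' ≫ f') ▷ Z := by simp [hg]

theorem IsBayesianInverse.symm {X Y : C} {p : 𝟙_ C ⟶ X} {f : X ⟶ Y} {g : Y ⟶ X}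
    (h : IsBayesianInverse p f g) : IsBayesianInverse (p ≫ f) g f := by
  unfold IsBayesianInverse
  calc (p ≫ f) ≫ Δ[Y] ≫ Y ◁ g
      = ((p ≫ f) ≫ Δ[Y] ≫ g ▷ Y) ≫ (β_ X Y).hom := by rw [copy_swap g]; simp only [Category.assoc]
    _ = (p ≫ Δ[X] ≫ X ◁ f) ≫ (β_ X Y).hom := by rw [← show _ = _ from h]
    _ = p ≫ Δ[X] ≫ f ▷ X := by rw [copy_swap' f, Category.assoc]
    _ = ((p ≫ f) ≫ g) ≫ Δ[X] ≫ f ▷ X := by rw [h.comp_eq]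

theorem asDeterministic_id {A X : C} (p : A ⟶ X) : ASDeterministic p (𝟙 X) := by
  simp [ASDeterministic, ASEq]

end Markov

namespace PS

variable {C : Type u} [Category.{v} C] [MonoidalCategory.{v} C] [MarkovCategory C]

theorem homMk_surjective [Causal C] {X Y : PS C} (f : X ⟶ Y) :
    ∃ (g : X.obj ⟶ Y.obj) (hg : X.state ≫ g = Y.state), homMk g hg = f := by
  obtain ⟨⟨g, hg⟩, rfl⟩ := Quotient.exists_rep f
  exact ⟨g, hg, rfl⟩

theorem homMk_comp_homMk [Causal C] {X Y Z : PS C} {f : X.obj ⟶ Y.obj} {g : Y.obj ⟶ Z.obj}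
    (hf : X.state ≫ f = Y.state) (hg : Y.state ≫ g = Z.state) :
    homMk f hf ≫ homMk g hg = homMk (f ≫ g) (by rw [← Category.assoc, hf, hg]) :=
  rfl

theorem isASDeterministic_id [Causal C] (X : PS C) : IsASDeterministic (𝟙 X) :=
  asDeterministic_id X.state

variable [HasConditionals C]

theorem dagger_id (X : PS C) : dagger (𝟙 X) = 𝟙 X :=
  dagger_homMk_eq_iff (hf := Category.comp_id _) (hg := Category.comp_id _) |>.2
    (isBayesianInverse_id X.state)

theorem dagger_comp {X Y Z : PS C} (f : X ⟶ Y) (g : Y ⟶ Z) :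
    dagger (f ≫ g) = dagger g ≫ dagger f := by
  obtain ⟨a, ha, rfl⟩ := homMk_surjective f
  obtain ⟨b, hb, rfl⟩ := homMk_surjective g
  obtain ⟨a', ha', hf⟩ := homMk_surjective (dagger (homMk a ha))
  obtain ⟨b', hb', hg⟩ := homMk_surjective (dagger (homMk b hb))
  rw [← hf, ← hg, homMk_comp_homMk, homMk_comp_homMk, dagger_homMk_eq_iff]
  refine (dagger_homMk_eq_iff.1 hf.symm).comp ?_
  rw [ha]
  exact dagger_homMk_eq_iff.1 hg.symm

theorem dagger_dagger {X Y : PS C} (f : X ⟶ Y) : dagger (dagger f) = f := by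
  obtain ⟨a, ha, rfl⟩ := homMk_surjective f
  obtain ⟨a', ha', hf⟩ := homMk_surjective (dagger (homMk a ha))
  rw [← hf, dagger_homMk_eq_iff, ← ha]
  exact (dagger_homMk_eq_iff.1 hf.symm).symm

theorem dagger_injective {X Y : PS C} : Function.Injective (dagger : (X ⟶ Y) → (Y ⟶ X)) :=
  Function.LeftInverse.injective dagger_dagger

theorem comp_dagger_eq_iff {X Y Z : PS C} {f : X ⟶ Z} {g : Y ⟶ Z} {h : X ⟶ Y} :
    f ≫ dagger g = h ↔ g ≫ dagger f = dagger h := by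
  rw [← dagger_injective.eq_iff, dagger_comp, dagger_dagger]

theorem IsASDeterministic.dagger_comp_comp {X Y Z : PS C} {f : X ⟶ Y} {g : Y ⟶ Z}
    (h : IsASDeterministic (f ≫ g)) : dagger (f ≫ g) ≫ f = dagger g := by
  obtain ⟨a, ha, rfl⟩ := homMk_surjective f
  obtain ⟨b, hb, rfl⟩ := homMk_surjective g
  rw [homMk_comp_homMk] at h ⊢
  have hab : X.state ≫ a ≫ b = Z.state := by rw [← Category.assoc, ha, hb]
  obtain ⟨k, hk, hdagger⟩ := homMk_surjective (dagger (homMk (a ≫ b) hab))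
  rw [← hdagger, homMk_comp_homMk, eq_comm, dagger_homMk_eq_iff, ← ha]
  exact .comp_of_asDeterministic h (dagger_homMk_eq_iff.1 hdagger.symm)

/-- Bayesian inversion as an identity-on-objects contravariant functor, i.e. the dagger structure of
`PS(C)`. -/
noncomputable def daggerFunctor : (PS C)ᵒᵖ ⥤ PS C where
  obj X := X.unop
  map f := dagger f.unop
  map_id X := dagger_id X.unop
  map_comp f g := dagger_comp g.unop f.unop

end PS

section DaggerLimits

variable {J : Type*} [Category* J] {C : Type u} [Category.{v} C] [MonoidalCategory.{v} C]
  [MarkovCategory C] [HasConditionals C] {D : J ⥤ PS C}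

/-- The cone over `D` formed by the Bayesian inverses of the legs of a cocone under `D`. -/
noncomputable def daggerCone (c : Cocone D) (hc : ∀ j, PS.IsASDeterministic (c.ι.app j)) :
    Cone D where
  pt := c.pt
  π :=
    { app := fun j => PS.dagger (c.ι.app j)
      naturality := fun i j m => by
        have hdet : PS.IsASDeterministic (D.map m ≫ c.ι.app j) := by rw [c.w]; exact hc i
        simpa using hdet.dagger_comp_comp.symm }

/-- The legs of a cocone under the reversed diagram `D†`, regarded as a cocone under `D` itself;
almost sure determinism of the legs makes them compatible with the morphisms of `D` as well. -/
noncomputable def coconeOfDagger (c : Cocone (D.op ⋙ PS.daggerFunctor))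
    (hc : ∀ j, PS.IsASDeterministic (c.ι.app j)) : Cocone D where
  pt := c.pt
  ι :=
    { app := fun j => c.ι.app (.op j)
      naturality := fun _ _ m =>
        (PS.dagger_injective ((PS.dagger_comp _ _).trans ((daggerCone c hc).w m.op))).trans
          (Category.comp_id _).symm }

end DaggerLimits

section SingleObj

/-- The one-object category of the opposite monoid is the opposite of the one-object category. -/
def singleObjOpEquivalence (M : Type w) [Monoid M] : SingleObj Mᵐᵒᵖ ≌ (SingleObj M)ᵒᵖ where
  functor :=
    { obj := fun _ => .op (SingleObj.star M)
      map := fun m => Quiver.Hom.op (MulOpposite.unop m) }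
  inverse :=
    { obj := fun _ => SingleObj.star Mᵐᵒᵖ
      map := fun m => MulOpposite.op (Quiver.Hom.unop m) }
  unitIso := Iso.refl _
  counitIso := Iso.refl _

variable {C : Type u} [Category.{v} C] [MonoidalCategory.{v} C] [MarkovCategory C]

theorem IsInvariantObject.isASDeterministic_leg [Causal C] {M : Type w} [Monoid M]
    {D : SingleObj M ⥤ PS C} {c : Cocone D} (hc : IsInvariantObject c) :
    PS.IsASDeterministic (leg c) := by
  obtain ⟨hcolim, hdet⟩ := hc
  rw [hdet c, hcolim.desc_self]
  exact PS.isASDeterministic_id _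

theorem HasInvariantObjects.exists_isColimit_op [Causal C] (hinv : HasInvariantObjects.{w} C)
    {M : Type w} [Monoid M] (G : (SingleObj M)ᵒᵖ ⥤ PS C) :
    ∃ c : Cocone G, Nonempty (IsColimit c) ∧ ∀ j, PS.IsASDeterministic (c.ι.app j) := by
  obtain ⟨c, hc⟩ := hinv Mᵐᵒᵖ ((singleObjOpEquivalence M).functor ⋙ G)
  exact ⟨c.whisker (singleObjOpEquivalence M).inverse,
    hc.elim fun hcolim _ => ⟨hcolim.whiskerEquivalence (singleObjOpEquivalence M).symm⟩,
    fun _ => hc.isASDeterministic_leg⟩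

theorem isLeftInvariant_π {M : Type w} [Monoid M] {E : Type u} [Category.{v} E]
    {D : SingleObj M ⥤ E} (s : Cone D) : IsLeftInvariant D (s.π.app (SingleObj.star M)) :=
  fun m => s.w m

theorem IsLeftInvariant.existsUnique_comp_eq {M : Type w} [Monoid M] {E : Type u} [Category.{v} E]
    {D : SingleObj M ⥤ E} {A : E} {g : A ⟶ space D} (hg : IsLeftInvariant D g) {s : Cone D}
    (hs : IsLimit s) : ∃! g' : A ⟶ s.pt, g' ≫ s.π.app (SingleObj.star M) = g :=
  ⟨hs.lift hg.cone, hs.fac hg.cone (SingleObj.star M),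
    fun g' hg' => hs.uniq hg.cone g' fun _ => hg'⟩

end SingleObj

end MarkovPS

open MarkovPS in
theorem mainTheorem2_general {J : Type*} [Category* J] {C : Type u} [Category.{v} C]
    [MonoidalCategory.{v} C] [MarkovCategory C] [HasConditionals C] {D : J ⥤ PS C}
    {c : Cocone D} (hc : IsColimit c) (hdet : ∀ j, PS.IsASDeterministic (c.ι.app j))
    {c' : Cocone (D.op ⋙ PS.daggerFunctor)} (hc' : IsColimit c')
    (hdet' : ∀ j, PS.IsASDeterministic (c'.ι.app j)) :
    Nonempty (IsLimit (daggerCone c hdet)) := by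
  let d := coconeOfDagger c' hdet'
  obtain ⟨u, hu⟩ : ∃ u : c.pt ⟶ d.pt, ∀ j, c.ι.app j ≫ u = d.ι.app j := ⟨hc.desc d, hc.fac d⟩
  refine ⟨.ofExistsUnique fun s => ?_⟩
  obtain ⟨k, hk⟩ : ∃ k : d.pt ⟶ s.pt, ∀ j, d.ι.app j ≫ k = PS.dagger (s.π.app j) :=
    ⟨hc'.desc (PS.daggerFunctor.mapCocone s.op), fun j => hc'.fac _ (.op j)⟩
  have huk (j : J) : c.ι.app j ≫ u ≫ k = PS.dagger (s.π.app j) := by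
    rw [reassoc_of% hu, hk]
  refine ⟨PS.dagger (u ≫ k), fun j => PS.comp_dagger_eq_iff.2 ?_, fun (l : s.pt ⟶ c.pt) hl => ?_⟩
  · exact (congrArg (c.ι.app j ≫ ·) (PS.dagger_dagger _)).trans (huk j)
  · have hl' : PS.dagger l = u ≫ k :=
      hc.hom_ext fun j => (PS.comp_dagger_eq_iff.1 (hl j)).trans (huk j).symm
    exact (PS.dagger_dagger l).symm.trans (congrArg PS.dagger hl')

theorem mainTheorem2 {C : Type u} [Category.{v} C] [MonoidalCategory.{v} C] [MarkovCategory C]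
    [MarkovPS.HasConditionals C] (hinv : MarkovPS.HasInvariantObjects.{w} C)
    {M : Type w} [Monoid M] (D : SingleObj M ⥤ MarkovPS.PS C)
    (c : Cocone D) (hc : MarkovPS.IsInvariantObject c) :
    (∃ h : MarkovPS.IsLeftInvariant D (MarkovPS.PS.dagger (MarkovPS.leg c)),
      Nonempty (IsLimit h.cone)) ∧
    ∀ (A : MarkovPS.PS C) (g : A ⟶ MarkovPS.space D), MarkovPS.IsLeftInvariant D g →
      ∃! g' : A ⟶ c.pt, g' ≫ MarkovPS.PS.dagger (MarkovPS.leg c) = g := by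
  obtain ⟨c', ⟨hc'⟩, hdet'⟩ := hinv.exists_isColimit_op (D.op ⋙ MarkovPS.PS.daggerFunctor)
  obtain ⟨hlim⟩ := mainTheorem2_general hc.choose (fun _ => hc.isASDeterministic_leg) hc' hdet'
  have hr := MarkovPS.isLeftInvariant_π (MarkovPS.daggerCone c fun _ => hc.isASDeterministic_leg)
  exact ⟨⟨hr, ⟨hlim⟩⟩, fun _ _ hg => hg.existsUnique_comp_eq hlim⟩
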